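/- Setting. Let $A:\mathbb R^d\to\mathbb R^{d\times d}$, $B\in\mathbb R^{d\times m}$, let $Q\in\mathbb R^{d\times d}$ be symmetric positive semidefinite, $R\in\mathbb R^{m\times m}$ symmetric positive definite, and $F=BR^{-1}B^\top$. Vectors carry the Euclidean norm and matrices the operator 2-norm. A real matrix is called stable if all its eigenvalues have negative real part; $(A,B)$ is stabilizable if $A-BK$ is stable for some $K\in\mathbb R^{m\times d}$; $(A,C)$ is detectable if $(A^\top,C^\top)$ is stabilizable. Write $P(x)$ for the symmetric positive semidefinite solution of the state-dependent Riccati equation (SDRE) $A(x)^\top P+PA(x)-PFP+Q=0$, write $A_{cl}(x)=A(x)-FP(x)$, and write $H(x)$ for the solution of the Lyapunov equation $A_{cl}(x)^\top H+HA_{cl}(x)=-I$. Let $\mathcal P\subset\mathbb R$, $\Omega\subset\mathbb R^d$ and $y_0:\mathcal P\to\Omega$, and assume: (a) $\|A_{cl}(x)-A_{cl}(y)\|\le L_{cl}\|x-y\|$ for all $x,y\in\Omega$, with $L_{cl}>0$; (b) $(A(x),B)$ is stabilizable for every $x\in\Omega$; (c) $(A(x),Q^{1/2})$ is detectable for every $x\in\Omega$;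 (d) $\|y_0(\mu)-y_0(\nu)\|\le L_{y_0}|\mu-\nu|$ for all $\mu,\nu\in\mathcal P$, with $L_{y_0}>0$; (e) $\|A(x)-A(y)\|\le L_A\|x-y\|$ for all $x,y\in\Omega$, with $L_A>0$. A number $L\in\mathbb R$ is called a one-sided Lipschitz constant (of the closed-loop vector field on $\Omega$) if $(A_{cl}(x)x-A_{cl}(y)y)\cdot(x-y)\le L\|x-y\|^2$ for all $x,y\in\Omega$. Proposition. For every $x\in\Omega$ the SDRE has exactly one positive semidefinite solution $P(x)$, and the Lyapunov equation has exactly one solution $H(x)$. If $\Omega$ is bounded, then $$\sup_{x\in\Omega}\operatorname{logm}(A_{cl}(x))+L_{cl}\sup_{y\in\Omega}\|y\|,\qquad \operatorname{logm}(M)=\sup_{0\ne x\in\mathbb C^d}\frac{\operatorname{Re}((Mx)\cdot x)}{\|x\|^2},$$ is a one-sided Lipschitz constant. Let $\mu\in\mathcal P$ and $\tilde\mu=\mu+\Delta\mu\in\mathcal P$ with $\Delta\mu>0$, and suppose $$\Delta\mu<\frac{1}{2L_AL_{y_0}\|H(y_0(\mu))\|}.\tag{1}$$ Then $A(y_0(\tilde\mu))-FP(y_0(\mu))$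 is stable. Suppose moreover that $T>0$, that for $\nu\in\{\mu,\tilde\mu\}$ the function $y(\cdot;\nu):[0,T]\to\Omega$ solves $\dot y=A_{cl}(y)y$ with $y(0;\nu)=y_0(\nu)$, and write $A_{\nu,t}=A(y(t;\nu))$, $P_{\nu,t}=P(y(t;\nu))$, $H_{\mu,t}=H(y(t;\mu))$. If some one-sided Lipschitz constant $L$ satisfies $$L<-\frac1t\log\bigl(2L_AL_{y_0}\,\Delta\mu\,\|H_{\mu,t}\|\bigr)\qquad\text{for all }t\in(0,T],\tag{2}$$ then for every $t\in[0,T]$ the matrix $A_{\tilde\mu,t}-FP_{\mu,t}$ is stable, and there is exactly one Newton–Kleinman sequence $(P^k)_{k\ge0}$, that is, exactly one sequence of real matrices with $P^0=P_{\mu,t}$ and $$(A_{\tilde\mu,t}-FP^k)^\top P^{k+1}+P^{k+1}(A_{\tilde\mu,t}-FP^k)=-P^kFP^k-Q,\qquad k\ge0,$$ and it converges to $P_{\tilde\mu,t}$, the unique positive semidefinite solution of the SDRE for the parameter $\tilde\mu$ at time $t$. -/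

import Mathlib

open Matrix Topology Filter

namespace SDRE

/-- The state space `ℝ^d` with the Euclidean norm. -/
abbrev State (d : ℕ) : Type := EuclideanSpace ℝ (Fin d)

/-- Real square matrices of size `d`. -/
abbrev Mat (d : ℕ) : Type := Matrix (Fin d) (Fin d) ℝ

/-- The operator 2-norm of a real square matrix. -/
noncomputable def opNorm {d : ℕ} (M : Mat d) : ℝ :=
  ‖Matrix.toEuclideanCLM (n := Fin d) (𝕜 := ℝ) M‖

/-- A real matrix is stable if all its complex eigenvalues lie in the open left half plane. -/
def IsStable {d : ℕ} (M : Mat d) : Prop :=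
  ∀ z ∈ spectrum ℂ (M.map (algebraMap ℝ ℂ)), z.re < 0

/-- `(A, B)` is stabilizable if some feedback matrix `K` makes `A - B K` stable. -/
def IsStabilizable {d m : ℕ} (A : Mat d) (B : Matrix (Fin d) (Fin m) ℝ) : Prop :=
  ∃ K : Matrix (Fin m) (Fin d) ℝ, IsStable (A - B * K)

/-- `(A, C)` is detectable if `(Aᵀ, Cᵀ)` is stabilizable. -/
def IsDetectable {d : ℕ} (A C : Mat d) : Prop :=
  IsStabilizable Aᵀ Cᵀ

section Sqrt
open scoped MatrixOrder

/-- The positive semidefinite square root `Q^{1/2}` of a positive semidefinite matrix. -/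
noncomputable def sqrtMat {d : ℕ} (Q : Mat d) : Mat d := CFC.sqrt Q

end Sqrt

/-- `F = B R⁻¹ Bᵀ`. -/
noncomputable def fMat {d m : ℕ} (B : Matrix (Fin d) (Fin m) ℝ)
    (R : Matrix (Fin m) (Fin m) ℝ) : Mat d :=
  B * R⁻¹ * Bᵀ

/-- `P` is a (symmetric) positive semidefinite solution of the algebraic Riccati equation
`Aᵀ P + P A - P F P + Q = 0`. -/
def IsRiccatiSolution {d : ℕ} (A F Q P : Mat d) : Prop :=
  P.PosSemidef ∧ Aᵀ * P + P * A - P * F * P + Q = 0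

open Classical in
/-- The positive semidefinite solution of the algebraic Riccati equation
(the zero matrix if there is none). -/
noncomputable def riccatiSolution {d : ℕ} (A F Q : Mat d) : Mat d :=
  if h : ∃ P, IsRiccatiSolution A F Q P then h.choose else 0

/-- The closed-loop matrix `A_cl(x) = A(x) - F P(x)`. -/
noncomputable def closedLoop {d : ℕ} (A : State d → Mat d) (F Q : Mat d) (x : State d) : Mat d :=
  A x - F * riccatiSolution (A x) F Q

/-- The closed-loop vector field `x ↦ A_cl(x) x`. -/
noncomputable def closedLoopField {d : ℕ} (A : State d → Mat d) (F Q : Mat d) (x : State d) :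
    State d :=
  Matrix.toEuclideanCLM (n := Fin d) (𝕜 := ℝ) (closedLoop A F Q x) x

/-- `H` solves the Lyapunov equation `Mᵀ H + H M = -I`. -/
def IsLyapunovSolution {d : ℕ} (M H : Mat d) : Prop :=
  Mᵀ * H + H * M = -1

open Classical in
/-- The solution of the Lyapunov equation `Mᵀ H + H M = -I` (the zero matrix if there is none). -/
noncomputable def lyapunovSolution {d : ℕ} (M : Mat d) : Mat d :=
  if h : ∃ H, IsLyapunovSolution M H then h.choose else 0

/-- `L` is a one-sided Lipschitz constant on `Ω` of the autonomous vector field `f`. -/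
def IsOneSidedLipschitz {d : ℕ} (Ω : Set (State d)) (f : State d → State d) (L : ℝ) : Prop :=
  ∀ x ∈ Ω, ∀ y ∈ Ω, inner ℝ (f x - f y) (x - y) ≤ L * ‖x - y‖ ^ 2

/-- The logarithmic norm of a complex matrix `M`: the supremum of `Re ((M x) · x) / ‖x‖²`
over all nonzero complex vectors `x`. -/
noncomputable def logNorm {d : ℕ} (M : Matrix (Fin d) (Fin d) ℂ) : ℝ :=
  ⨆ x : {x : EuclideanSpace ℂ (Fin d) // x ≠ 0},
    (inner ℂ x.1 (Matrix.toEuclideanCLM (n := Fin d) (𝕜 := ℂ) M x.1)).re / ‖x.1‖ ^ 2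

/-- The constant `sup_{x ∈ Ω} logm(A_cl(x)) + L_cl sup_{y ∈ Ω} ‖y‖`. -/
noncomputable def closedLoopConstant {d : ℕ} (A : State d → Mat d) (F Q : Mat d)
    (Ω : Set (State d)) (Lcl : ℝ) : ℝ :=
  (⨆ x : Ω, logNorm ((closedLoop A F Q x.1).map (algebraMap ℝ ℂ))) + Lcl * ⨆ y : Ω, ‖y.1‖

/-- `y` solves `y' = A_cl(y) y`, `y(0) = z` on `[0, T]` (one-sided derivatives at the endpoints)
and stays in `Ω`. -/
def IsTrajectory {d : ℕ} (A : State d → Mat d) (F Q : Mat d) (Ω : Set (State d)) (T : ℝ)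
    (z : State d) (y : ℝ → State d) : Prop :=
  y 0 = z ∧ ∀ t ∈ Set.Icc 0 T,
    y t ∈ Ω ∧ HasDerivWithinAt y (closedLoopField A F Q (y t)) (Set.Icc 0 T) t

/-- `S` is a Newton-Kleinman sequence for the Riccati equation with data `A, F, Q` and initial
guess `P₀`: with `A_k = A - F S_k`, one has `A_kᵀ S_{k+1} + S_{k+1} A_k = - S_k F S_k - Q`. -/
def IsNewtonKleinman {d : ℕ} (A F Q P₀ : Mat d) (S : ℕ → Mat d) : Prop :=
  S 0 = P₀ ∧ ∀ k,
    (A - F * S k)ᵀ * S (k + 1) + S (k + 1) * (A - F * S k) = -(S k * F * S k) - Q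

end SDRE

namespace SDRE

/-! Everything rests on Lyapunov equations, treated without matrix exponentials. The Cayley
transform N = (1 + M)(1 - M)⁻¹ of a stable M has powers tending to 0, and it turns MᵀX + XM into a
discrete difference X - NᵀXN up to congruence. Iterating gives unique solvability
(`sylvester_eq_zero`) and positivity (`lyapunov_posSemidef`); conversely, a semidefinite solution
gives stability if its right-hand side sees every unstable mode (`isStable_of_lyapunov`).

Completing the square then shows that a Newton-Kleinman step preserves stability of the closed loop
and, after the first step, decreases the iterates (`kleinman_step`, `kleinman_step_antitone`). The
limit solves the Riccati equation; started from any stabilizing feedback, this also yields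
existence. Detectability makes every semidefinite solution stabilizing, and the difference of two
such solutions satisfies a homogeneous Sylvester equation, hence vanishes.

What remains is to show that the old feedback stabilizes the new system. The perturbation is E =
A(y(t; μ̃)) - A(y(t; μ)), and H stays a Lyapunov function while 2‖E‖‖H‖ < 1
(`IsStable.add_of_opNorm_lt`). A Gronwall estimate gives ‖E‖ ≤ L_A e^{Lt} L_{y₀} Δμ, so (2) is just
this smallness condition. -/

/-! ### Stable matrices -/

/-- `a + i b` is an eigenvector of the real matrix `M` for the eigenvalue `σ + i ω`. -/
structure IsEigenpair {d : ℕ} (M : Mat d) (σ ω : ℝ) (a b : Fin d → ℝ) : Prop where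
  ne_zero : a ≠ 0 ∨ b ≠ 0
  left : M *ᵥ a = σ • a - ω • b
  right : M *ᵥ b = ω • a + σ • b

lemma mem_spectrum_iff_exists_mulVec {d : ℕ} {M : Matrix (Fin d) (Fin d) ℂ} {z : ℂ} :
    z ∈ spectrum ℂ M ↔ ∃ v, v ≠ 0 ∧ M *ᵥ v = z • v := by
  rw [spectrum.mem_iff, Matrix.isUnit_iff_isUnit_det, isUnit_iff_ne_zero, not_not,
    ← Matrix.exists_mulVec_eq_zero_iff]
  refine exists_congr fun v => and_congr_right fun _ => ?_
  rw [Matrix.sub_mulVec, Matrix.algebraMap_eq_diagonal, sub_eq_zero, eq_comm]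
  have : diagonal ((algebraMap ℂ (Fin d → ℂ)) z) *ᵥ v = z • v := by
    ext i; simp [Matrix.mulVec_diagonal]
  rw [this]

lemma re_map_mulVec {d : ℕ} (M : Mat d) (v : Fin d → ℂ) (i : Fin d) :
    ((M.map (algebraMap ℝ ℂ) *ᵥ v) i).re = (M *ᵥ fun j => (v j).re) i := by
  simp [Matrix.mulVec, dotProduct]

lemma im_map_mulVec {d : ℕ} (M : Mat d) (v : Fin d → ℂ) (i : Fin d) :
    ((M.map (algebraMap ℝ ℂ) *ᵥ v) i).im = (M *ᵥ fun j => (v j).im) i := by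
  simp [Matrix.mulVec, dotProduct]

/-- Splitting eigenvectors into real and imaginary parts lets the later Lyapunov arguments use real
quadratic forms only. -/
lemma mem_spectrum_map_iff {d : ℕ} {M : Mat d} {z : ℂ} :
    z ∈ spectrum ℂ (M.map (algebraMap ℝ ℂ)) ↔ ∃ a b, IsEigenpair M z.re z.im a b := by
  rw [mem_spectrum_iff_exists_mulVec]
  constructor
  · rintro ⟨v, hv, h⟩
    refine ⟨fun j => (v j).re, fun j => (v j).im, ?_, ?_, ?_⟩
    · by_contra! hc
      exact hv (funext fun i => Complex.ext (congrFun hc.1 i) (congrFun hc.2 i))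
    · ext i
      rw [← re_map_mulVec, h]; simp
    · ext i
      rw [← im_map_mulVec, h]; simp; ring
  · rintro ⟨a, b, hne, ha, hb⟩
    refine ⟨fun j => ⟨a j, b j⟩, fun h0 => ?_, ?_⟩
    · rcases hne with h | h
      · exact h (funext fun i => congrArg Complex.re (congrFun h0 i))
      · exact h (funext fun i => congrArg Complex.im (congrFun h0 i))
    · ext i
      apply Complex.ext
      · rw [re_map_mulVec]; simp [ha]
      · rw [im_map_mulVec]; simp [hb]; ring

lemma isStable_iff {d : ℕ} {M : Mat d} :
    IsStable M ↔ ∀ σ ω a b, IsEigenpair M σ ω a b → σ < 0 := by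
  constructor
  · intro h σ ω a b hab
    exact h ⟨σ, ω⟩ (mem_spectrum_map_iff.2 ⟨a, b, hab⟩)
  · intro h z hz
    obtain ⟨a, b, hab⟩ := mem_spectrum_map_iff.1 hz
    exact h _ _ a b hab

lemma IsStable.transpose {d : ℕ} {M : Mat d} (h : IsStable M) : IsStable Mᵀ := by
  intro z hz
  refine h z ?_
  rw [spectrum.mem_iff, Matrix.isUnit_iff_isUnit_det] at hz ⊢
  rw [← Matrix.det_transpose]
  simpa [Matrix.transpose_map, Matrix.transpose_sub, Matrix.algebraMap_eq_diagonal] using hz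

/-! ### Powers of matrices with spectral radius below one -/

section Gelfand
attribute [local instance] Matrix.linftyOpNormedRing Matrix.linftyOpNormedAlgebra

/-- By Gelfand's formula ‖M^k‖^(1/k) tends to the spectral radius, so eventually ‖M^k‖ < r^k for
some r < 1. -/
lemma tendsto_pow_of_spectrum_lt_one {d : ℕ} {M : Matrix (Fin d) (Fin d) ℂ}
    (h : ∀ z ∈ spectrum ℂ M, ‖z‖ < 1) : Tendsto (fun k : ℕ => M ^ k) atTop (𝓝 0) := by
  rcases subsingleton_or_nontrivial (Matrix (Fin d) (Fin d) ℂ) with hs | hs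
  · have : (fun k : ℕ => M ^ k) = fun _ => 0 := funext fun k => Subsingleton.elim _ _
    rw [this]; exact tendsto_const_nhds
  have hr : spectralRadius ℂ M < ((1 : NNReal) : ENNReal) :=
    spectrum.spectralRadius_lt_of_forall_lt M fun z hz => by
      rw [← NNReal.coe_lt_coe]; simpa using h z hz
  obtain ⟨r, hr1, hr2⟩ := ENNReal.lt_iff_exists_nnreal_btwn.1 hr
  have hlim := spectrum.pow_nnnorm_pow_one_div_tendsto_nhds_spectralRadius M
  have hev := hlim.eventually (gt_mem_nhds hr1)
  have hr2' : (r : ℝ) < 1 := by exact_mod_cast hr2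
  refine squeeze_zero_norm' ?_ (tendsto_pow_atTop_nhds_zero_of_lt_one r.2 hr2')
  filter_upwards [hev, eventually_gt_atTop 0] with k hk hk0
  have hk' : ((‖M ^ k‖₊ : ENNReal)) < (r : ENNReal) ^ k := by
    have := ENNReal.rpow_lt_rpow hk (z := (k : ℝ)) (by exact_mod_cast hk0)
    rw [← ENNReal.rpow_mul, one_div, inv_mul_cancel₀ (by exact_mod_cast hk0.ne'),
      ENNReal.rpow_one, ENNReal.rpow_natCast] at this
    exact this
  have : ‖M ^ k‖₊ < r ^ k := by exact_mod_cast hk'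
  exact_mod_cast this.le

end Gelfand

lemma IsStable.isUnit_one_sub {d : ℕ} {M : Mat d} (h : IsStable M) : IsUnit (1 - M) := by
  rw [Matrix.isUnit_iff_isUnit_det, isUnit_iff_ne_zero]
  intro h0
  obtain ⟨v, hv, hv0⟩ := Matrix.exists_mulVec_eq_zero_iff.2 h0
  have := isStable_iff.1 h 1 0 v 0 ⟨Or.inl hv, ?_, by simp⟩
  · linarith
  · rw [Matrix.sub_mulVec, Matrix.one_mulVec, sub_eq_zero] at hv0
    simp [← hv0]

/-- The Cayley transform of a stable matrix is power convergent to zero. -/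
lemma IsStable.exists_cayley {d : ℕ} {M : Mat d} (h : IsStable M) :
    ∃ N : Mat d, N * (1 - M) = 1 + M ∧ Tendsto (fun k : ℕ => N ^ k) atTop (𝓝 0) := by
  have hu := h.isUnit_one_sub
  have hdet := (Matrix.isUnit_iff_isUnit_det _).1 hu
  refine ⟨(1 + M) * (1 - M)⁻¹, by rw [mul_assoc, Matrix.nonsing_inv_mul _ hdet, mul_one], ?_⟩
  set N := (1 + M) * (1 - M)⁻¹ with hN
  have hcomm : N * (1 - M) = 1 + M := by
    rw [hN, mul_assoc, Matrix.nonsing_inv_mul _ hdet, mul_one]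
  have hcomm' : (1 - M) * N = 1 + M := by
    have h1 : (1 + M) * (1 - M) = (1 - M) * (1 + M) := by noncomm_ring
    rw [hN, ← mul_assoc, ← h1, mul_assoc, Matrix.mul_nonsing_inv _ hdet, mul_one]
  have hspec : ∀ z ∈ spectrum ℂ (N.map (algebraMap ℝ ℂ)), ‖z‖ < 1 := by
    intro z hz
    obtain ⟨v, hv, hvz⟩ := mem_spectrum_iff_exists_mulVec.1 hz
    set Mc := M.map (algebraMap ℝ ℂ) with hMc
    have hc : (1 - Mc) * N.map (algebraMap ℝ ℂ) = 1 + Mc := by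
      have := congrArg (fun X : Mat d => X.map (algebraMap ℝ ℂ)) hcomm'
      have h1 : ((1 : Mat d) - M).map (algebraMap ℝ ℂ) = 1 - Mc :=
        map_sub (algebraMap ℝ ℂ).mapMatrix 1 M |>.trans (by rw [map_one]; rfl)
      have h2 : ((1 : Mat d) + M).map (algebraMap ℝ ℂ) = 1 + Mc :=
        map_add (algebraMap ℝ ℂ).mapMatrix 1 M |>.trans (by rw [map_one]; rfl)
      rw [← h1, ← h2, ← this]
      exact Matrix.map_mul.symm
    have hv1 : (1 + Mc) *ᵥ v = z • ((1 - Mc) *ᵥ v) := by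
      rw [← hc, ← Matrix.mulVec_mulVec, hvz, Matrix.mulVec_smul]
    rw [Matrix.add_mulVec, Matrix.sub_mulVec, Matrix.one_mulVec] at hv1
    have hv2 : (z + 1) • (Mc *ᵥ v) = (z - 1) • v := by
      ext i
      have := congrFun hv1 i
      simp only [Pi.add_apply, Pi.smul_apply, Pi.sub_apply, smul_eq_mul] at this ⊢
      linear_combination this
    have hz1 : z + 1 ≠ 0 := by
      intro h0
      have hz' : z = -1 := by linear_combination h0
      rw [h0, zero_smul, hz'] at hv2
      rcases smul_eq_zero.1 hv2.symm with h | h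
      · norm_num at h
      · exact hv h
    -- The inverse Cayley transform of z is an eigenvalue of M; its real part is (|z|² - 1)/|z +
    -- 1|², so stability forces |z| < 1.
    have hmem : (z - 1) / (z + 1) ∈ spectrum ℂ Mc := by
      refine mem_spectrum_iff_exists_mulVec.2 ⟨v, hv, ?_⟩
      rw [div_eq_inv_mul, mul_smul, ← hv2, smul_smul, inv_mul_cancel₀ hz1, one_smul]
    have hre := h _ hmem
    rw [Complex.div_re, ← add_div] at hre
    have hpos : 0 < Complex.normSq (z + 1) := Complex.normSq_pos.2 hz1
    have := (div_neg_iff.1 hre).resolve_left (fun h => absurd h.2 (not_lt.2 hpos.le))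
    simp at this
    rw [← sq_lt_one_iff₀ (norm_nonneg _), ← Complex.normSq_eq_norm_sq, Complex.normSq_apply]
    nlinarith [this.1]
  have hlim := tendsto_pow_of_spectrum_lt_one hspec
  refine tendsto_pi_nhds.2 fun i => tendsto_pi_nhds.2 fun j => ?_
  have h1 := (tendsto_pi_nhds.1 (tendsto_pi_nhds.1 hlim i)) j
  have h2 := (Complex.continuous_re.tendsto _).comp h1
  have h3 : ∀ k, (N.map (algebraMap ℝ ℂ)) ^ k = (N ^ k).map (algebraMap ℝ ℂ) := by
    intro k
    exact ((algebraMap ℝ ℂ).mapMatrix.map_pow N k).symm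
  refine h2.congr fun k => ?_
  rw [Function.comp_apply, h3 k]
  exact Complex.ofReal_re _

/-! ### Lyapunov and Sylvester equations -/

/-- Since (1 - M₁)ᵀX(1 - M₂) - (1 + M₁)ᵀX(1 + M₂) = -2(M₁ᵀX + XM₂), X is fixed by X ↦ N₁ᵀXN₂, whose
iterates tend to 0. -/
lemma sylvester_eq_zero {d : ℕ} {M₁ M₂ X : Mat d} (h₁ : IsStable M₁) (h₂ : IsStable M₂)
    (h : M₁ᵀ * X + X * M₂ = 0) : X = 0 := by
  obtain ⟨N₁, e₁, l₁⟩ := h₁.exists_cayley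
  obtain ⟨N₂, e₂, l₂⟩ := h₂.exists_cayley
  have ht : (1 - M₁)ᵀ * N₁ᵀ = (1 + M₁)ᵀ := by rw [← Matrix.transpose_mul, e₁]
  have hstep : X = N₁ᵀ * X * N₂ := by
    have hu₁ : IsUnit (1 - M₁)ᵀ := by
      have := (Matrix.isUnit_iff_isUnit_det _).1 h₁.isUnit_one_sub
      rw [Matrix.isUnit_iff_isUnit_det, Matrix.det_transpose]; exact this
    refine hu₁.mul_left_cancel (h₂.isUnit_one_sub.mul_right_cancel ?_)
    have : (1 - M₁)ᵀ * (N₁ᵀ * X * N₂) * (1 - M₂) = (1 + M₁)ᵀ * X * (1 + M₂) := by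
      rw [← ht, ← e₂]; noncomm_ring
    rw [this, ← sub_eq_zero]
    have : (1 - M₁)ᵀ * X * (1 - M₂) - (1 + M₁)ᵀ * X * (1 + M₂)
        = (-2 : ℤ) • (M₁ᵀ * X + X * M₂) := by
      simp only [Matrix.transpose_sub, Matrix.transpose_add, Matrix.transpose_one]
      noncomm_ring
    rw [this, h, smul_zero]
  have hk : ∀ k : ℕ, X = (N₁ ^ k)ᵀ * X * N₂ ^ k := by
    intro k
    induction k with
    | zero => simp
    | succ k ih =>
      calc X = (N₁ ^ k)ᵀ * X * N₂ ^ k := ih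
        _ = (N₁ ^ k)ᵀ * (N₁ᵀ * X * N₂) * N₂ ^ k := by rw [← hstep]
        _ = _ := by
          rw [pow_succ' N₁, pow_succ' N₂, Matrix.transpose_mul]; noncomm_ring
  have hc : Tendsto (fun k : ℕ => (N₁ ^ k)ᵀ * X * N₂ ^ k) atTop (𝓝 ((0 : Mat d)ᵀ * X * 0)) := by
    have ht : Tendsto (fun k : ℕ => (N₁ ^ k)ᵀ) atTop (𝓝 (0 : Mat d)ᵀ) :=
      ((continuous_id.matrix_transpose).tendsto (0 : Mat d)).comp l₁
    exact (ht.mul tendsto_const_nhds).mul l₂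
  have hc' : Tendsto (fun _ : ℕ => X) atTop (𝓝 0) := by
    rw [mul_zero] at hc
    exact hc.congr fun k => (hk k).symm
  exact tendsto_nhds_unique tendsto_const_nhds hc'

lemma existsUnique_lyapunov {d : ℕ} {M : Mat d} (h : IsStable M) (C : Mat d) :
    ∃! X, Mᵀ * X + X * M = C := by
  let f : Mat d →ₗ[ℝ] Mat d := LinearMap.mulLeft ℝ Mᵀ + LinearMap.mulRight ℝ M
  have hf : ∀ X, f X = Mᵀ * X + X * M := fun X => rfl
  have hinj : Function.Injective f := by
    rw [← LinearMap.ker_eq_bot, LinearMap.ker_eq_bot']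
    intro X hX
    exact sylvester_eq_zero h h hX
  exact Function.Bijective.existsUnique ⟨hinj, LinearMap.injective_iff_surjective.1 hinj⟩ C

lemma dotProduct_lyapunov {d : ℕ} {M X : Mat d} (hX : Xᵀ = X) (x : Fin d → ℝ) :
    x ⬝ᵥ (Mᵀ * X + X * M) *ᵥ x = 2 * (x ⬝ᵥ X *ᵥ (M *ᵥ x)) := by
  have h1 : x ⬝ᵥ (Mᵀ * X) *ᵥ x = x ⬝ᵥ (X * M) *ᵥ x := by
    rw [← Matrix.dotProduct_transpose_mulVec, dotProduct_comm]
    rw [Matrix.transpose_mul, hX, Matrix.transpose_transpose, dotProduct_comm]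
  rw [Matrix.add_mulVec, dotProduct_add, h1, Matrix.mulVec_mulVec]; ring

lemma posSemidef_iff_real {d : ℕ} {M : Matrix (Fin d) (Fin d) ℝ} :
    M.PosSemidef ↔ Mᵀ = M ∧ ∀ x, 0 ≤ x ⬝ᵥ M *ᵥ x := by
  rw [Matrix.posSemidef_iff_dotProduct_mulVec]
  simp [Matrix.IsHermitian, Matrix.conjTranspose_eq_transpose_of_trivial]

/-- Symmetry follows from uniqueness. For y = (1 - M)x one has Ny = (1 + M)x, and the form of X
drops by 2xᵀWx ≥ 0 from y to Ny. Along N^k y it therefore decreases, and its limit is 0. -/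
lemma lyapunov_posSemidef {d : ℕ} {M X W : Mat d} (h : IsStable M) (hW : W.PosSemidef)
    (hX : Mᵀ * X + X * M = -W) : X.PosSemidef := by
  rw [posSemidef_iff_real] at hW ⊢
  have hsymm : Xᵀ = X := by
    refine (existsUnique_lyapunov h (-W)).unique ?_ hX
    have := congrArg Matrix.transpose hX
    rw [Matrix.transpose_add, Matrix.transpose_mul, Matrix.transpose_mul,
      Matrix.transpose_transpose, Matrix.transpose_neg, hW.1, add_comm] at this
    exact this
  refine ⟨hsymm, ?_⟩
  obtain ⟨N, e, l⟩ := h.exists_cayley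
  have hdet := (Matrix.isUnit_iff_isUnit_det _).1 h.isUnit_one_sub
  have hstep : ∀ y, (N *ᵥ y) ⬝ᵥ X *ᵥ (N *ᵥ y) ≤ y ⬝ᵥ X *ᵥ y := by
    intro y
    obtain ⟨x, rfl⟩ : ∃ x, (1 - M) *ᵥ x = y :=
      ⟨(1 - M)⁻¹ *ᵥ y, by rw [Matrix.mulVec_mulVec, Matrix.mul_nonsing_inv _ hdet,
        Matrix.one_mulVec]⟩
    rw [Matrix.mulVec_mulVec, e]
    have h1 := dotProduct_lyapunov (M := M) hsymm x
    rw [hX, Matrix.neg_mulVec, dotProduct_neg] at h1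
    have h2 : (M *ᵥ x) ⬝ᵥ X *ᵥ x = x ⬝ᵥ X *ᵥ (M *ᵥ x) := by
      rw [← Matrix.dotProduct_transpose_mulVec, hsymm, dotProduct_comm]
    have h3 := hW.2 x
    simp only [Matrix.add_mulVec, Matrix.sub_mulVec, Matrix.one_mulVec, Matrix.mulVec_add,
      Matrix.mulVec_sub, add_dotProduct, sub_dotProduct, dotProduct_add, dotProduct_sub]
    linarith
  intro y
  have hk : ∀ k : ℕ, ((N ^ k) *ᵥ y) ⬝ᵥ X *ᵥ ((N ^ k) *ᵥ y) ≤ y ⬝ᵥ X *ᵥ y := by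
    intro k
    induction k with
    | zero => simp
    | succ k ih =>
      rw [pow_succ', ← Matrix.mulVec_mulVec]
      exact (hstep _).trans ih
  have hcont : Continuous fun Y : Mat d => (Y *ᵥ y) ⬝ᵥ X *ᵥ (Y *ᵥ y) := by fun_prop
  have hl := (hcont.tendsto 0).comp l
  refine le_of_tendsto' (by simpa [Function.comp_def] using hl) hk

/-- Lyapunov's criterion, with a semidefinite right-hand side that detects unstable modes. -/
lemma isStable_of_lyapunov {d : ℕ} {M X W : Mat d} (hX : X.PosSemidef)
    (hW : ∀ x, 0 ≤ x ⬝ᵥ W *ᵥ x) (h : Mᵀ * X + X * M = -W)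
    (hdetect : ∀ σ ω a b, 0 ≤ σ → IsEigenpair M σ ω a b →
      a ⬝ᵥ W *ᵥ a = 0 → b ⬝ᵥ W *ᵥ b = 0 → False) : IsStable M := by
  rw [posSemidef_iff_real] at hX
  rw [isStable_iff]
  intro σ ω a b hab
  by_contra! hσ
  have ha := dotProduct_lyapunov (M := M) hX.1 a
  have hb := dotProduct_lyapunov (M := M) hX.1 b
  have hsym : a ⬝ᵥ X *ᵥ b = b ⬝ᵥ X *ᵥ a := by
    rw [← Matrix.dotProduct_transpose_mulVec, hX.1, dotProduct_comm]
  rw [h, Matrix.neg_mulVec, dotProduct_neg, hab.left] at ha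
  rw [h, Matrix.neg_mulVec, dotProduct_neg, hab.right] at hb
  simp only [Matrix.mulVec_add, Matrix.mulVec_sub, Matrix.mulVec_smul, dotProduct_add,
    dotProduct_sub, dotProduct_smul, smul_eq_mul] at ha hb
  rw [hsym] at ha
  -- In the sum of `ha` and `hb` the ω-terms cancel: aᵀWa + bᵀWb = -2σ(aᵀXa + bᵀXb) ≤ 0.
  have h1 := mul_nonneg hσ (hX.2 a)
  have h2 := mul_nonneg hσ (hX.2 b)
  have h3 := hW a
  have h4 := hW b
  exact hdetect σ ω a b hσ hab (by linarith) (by linarith)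

/-! ### The Riccati equation and the Newton-Kleinman iteration -/

lemma dotProduct_conj_mulVec {d m : ℕ} (R : Matrix (Fin m) (Fin m) ℝ)
    (S : Matrix (Fin m) (Fin d) ℝ) (x : Fin d → ℝ) :
    x ⬝ᵥ (Sᵀ * R * S) *ᵥ x = (S *ᵥ x) ⬝ᵥ R *ᵥ (S *ᵥ x) := by
  rw [Matrix.mul_assoc, ← Matrix.mulVec_mulVec, Matrix.dotProduct_transpose_mulVec, dotProduct_comm,
    ← Matrix.mulVec_mulVec]

lemma posSemidef_conj {d m : ℕ} {R : Matrix (Fin m) (Fin m) ℝ} (hR : R.PosSemidef)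
    (S : Matrix (Fin m) (Fin d) ℝ) : (Sᵀ * R * S).PosSemidef := by
  simpa [Matrix.conjTranspose_eq_transpose_of_trivial] using hR.conjTranspose_mul_mul_same S

lemma mulVec_eq_zero_of_dotProduct_eq_zero {d m : ℕ} {R : Matrix (Fin m) (Fin m) ℝ}
    (hR : R.PosDef) {S : Matrix (Fin m) (Fin d) ℝ} {x : Fin d → ℝ}
    (h : x ⬝ᵥ (Sᵀ * R * S) *ᵥ x = 0) : S *ᵥ x = 0 := by
  rw [dotProduct_conj_mulVec] at h
  by_contra h0
  have := hR.dotProduct_mulVec_pos h0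
  rw [star_trivial] at this
  exact this.ne' h

/-- The feedback gain `R⁻¹ Bᵀ P`. -/
noncomputable def gain {d m : ℕ} (B : Matrix (Fin d) (Fin m) ℝ)
    (R : Matrix (Fin m) (Fin m) ℝ) (P : Mat d) : Matrix (Fin m) (Fin d) ℝ :=
  R⁻¹ * Bᵀ * P

section
variable {d m : ℕ} {A Q P : Mat d} {B : Matrix (Fin d) (Fin m) ℝ}
  {R : Matrix (Fin m) (Fin m) ℝ}

lemma fMat_mul : fMat B R * P = B * gain B R P := by
  simp only [fMat, gain, Matrix.mul_assoc]

lemma transpose_fMat (hR : R.PosDef) : (fMat B R)ᵀ = fMat B R := by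
  simp only [fMat, Matrix.transpose_mul, Matrix.transpose_transpose, Matrix.transpose_nonsing_inv,
    (posSemidef_iff_real.1 hR.posSemidef).1, Matrix.mul_assoc]

lemma mul_gain (hR : R.PosDef) : R * gain B R P = Bᵀ * P := by
  have : IsUnit R.det := (Matrix.isUnit_iff_isUnit_det _).1 hR.isUnit
  rw [gain, ← Matrix.mul_assoc, ← Matrix.mul_assoc, Matrix.mul_nonsing_inv _ this, Matrix.one_mul]

lemma transpose_gain_mul (hR : R.PosDef) (hP : Pᵀ = P) : (gain B R P)ᵀ * R = P * B := by
  have h := congrArg Matrix.transpose (mul_gain (P := P) (B := B) hR)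
  rw [Matrix.transpose_mul, Matrix.transpose_mul, hP, Matrix.transpose_transpose,
    (posSemidef_iff_real.1 hR.posSemidef).1] at h
  exact h

lemma mul_fMat_mul (hR : R.PosDef) (hP : Pᵀ = P) :
    P * fMat B R * P = (gain B R P)ᵀ * R * gain B R P := by
  rw [Matrix.mul_assoc P, fMat_mul, transpose_gain_mul hR hP, Matrix.mul_assoc]

/-- Completion of the square in K, using PB = GᵀR for the new gain G. -/
lemma kleinman_identity {K : Matrix (Fin m) (Fin d) ℝ} (hR : R.PosDef) (hP : Pᵀ = P)
    (h : (A - B * K)ᵀ * P + P * (A - B * K) = -(Kᵀ * R * K) - Q) :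
    (A - fMat B R * P)ᵀ * P + P * (A - fMat B R * P) =
      -((K - gain B R P)ᵀ * R * (K - gain B R P) + (P * fMat B R * P + Q)) := by
  rw [mul_fMat_mul hR hP, fMat_mul]
  have h1 := mul_gain (P := P) (B := B) hR
  have h2 := transpose_gain_mul (B := B) hR hP
  set G := gain B R P
  simp only [Matrix.transpose_sub, Matrix.transpose_mul, Matrix.sub_mul, Matrix.mul_sub,
    Matrix.mul_assoc] at h ⊢
  rw [← Matrix.mul_assoc P, ← h2, ← h1, Matrix.mul_assoc] at h ⊢
  rw [← sub_eq_zero] at h ⊢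
  rw [← h]
  abel

/-- An unstable mode of the new closed loop would annihilate the square in K - G. Old and new
feedback would then agree on it, making it an unstable mode of the old closed loop. Detectability
plays no role. -/
lemma kleinman_step {K : Matrix (Fin m) (Fin d) ℝ} (hQ : Q.PosSemidef) (hR : R.PosDef)
    (hK : IsStable (A - B * K))
    (h : (A - B * K)ᵀ * P + P * (A - B * K) = -(Kᵀ * R * K) - Q) :
    P.PosSemidef ∧ IsStable (A - fMat B R * P) := by
  have hP : P.PosSemidef :=
    lyapunov_posSemidef hK ((posSemidef_conj hR.posSemidef K).add hQ) (by rw [h]; abel)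
  refine ⟨hP, ?_⟩
  have hPt := (posSemidef_iff_real.1 hP).1
  have hid := kleinman_identity hR hPt h
  have p1 := posSemidef_conj hR.posSemidef (K - gain B R P)
  have p2 : (P * fMat B R * P).PosSemidef := by
    rw [mul_fMat_mul hR hPt]; exact posSemidef_conj hR.posSemidef _
  have p3 := p2.add hQ
  refine isStable_of_lyapunov hP (posSemidef_iff_real.1 (p1.add p3)).2 hid ?_
  intro σ ω a b hσ hab ha hb
  have key : ∀ x, x ⬝ᵥ ((K - gain B R P)ᵀ * R * (K - gain B R P) +
      (P * fMat B R * P + Q)) *ᵥ x = 0 →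
      (A - B * K) *ᵥ x = (A - fMat B R * P) *ᵥ x := by
    intro x hx
    rw [Matrix.add_mulVec, dotProduct_add] at hx
    have q1 := (posSemidef_iff_real.1 p1).2 x
    have q2 := (posSemidef_iff_real.1 p3).2 x
    have := mulVec_eq_zero_of_dotProduct_eq_zero hR (S := K - gain B R P) (x := x) (by linarith)
    rw [Matrix.sub_mulVec, sub_eq_zero] at this
    rw [fMat_mul, Matrix.sub_mulVec, Matrix.sub_mulVec, ← Matrix.mulVec_mulVec, this,
      Matrix.mulVec_mulVec]
  have := isStable_iff.1 hK σ ω a b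
    ⟨hab.ne_zero, (key a ha).trans hab.left, (key b hb).trans hab.right⟩
  linarith

lemma kleinman_step_antitone {K : Matrix (Fin m) (Fin d) ℝ} {P' : Mat d}
    (hQ : Q.PosSemidef) (hR : R.PosDef) (hK : IsStable (A - B * K))
    (h : (A - B * K)ᵀ * P + P * (A - B * K) = -(Kᵀ * R * K) - Q)
    (h' : (A - fMat B R * P)ᵀ * P' + P' * (A - fMat B R * P) = -(P * fMat B R * P) - Q) :
    (P - P').PosSemidef := by
  obtain ⟨hP, hs⟩ := kleinman_step hQ hR hK h
  refine lyapunov_posSemidef hs (posSemidef_conj hR.posSemidef (K - gain B R P)) ?_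
  have hid := kleinman_identity hR (posSemidef_iff_real.1 hP).1 h
  have e : (A - fMat B R * P)ᵀ * (P - P') + (P - P') * (A - fMat B R * P) =
      ((A - fMat B R * P)ᵀ * P + P * (A - fMat B R * P)) -
      ((A - fMat B R * P)ᵀ * P' + P' * (A - fMat B R * P)) := by noncomm_ring
  rw [e, hid, h']; abel

lemma IsNewtonKleinman.isStable {S : ℕ → Mat d} (hQ : Q.PosSemidef) (hR : R.PosDef)
    (hP : Pᵀ = P) (hs : IsStable (A - fMat B R * P))
    (hS : IsNewtonKleinman A (fMat B R) Q P S) (k : ℕ) :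
    (S k)ᵀ = S k ∧ IsStable (A - fMat B R * S k) := by
  induction k with
  | zero => rw [hS.1]; exact ⟨hP, hs⟩
  | succ k ih =>
    have h := hS.2 k
    rw [mul_fMat_mul hR ih.1, fMat_mul] at h
    rw [fMat_mul] at ih
    obtain ⟨h1, h2⟩ := kleinman_step hQ hR ih.2 h
    exact ⟨(posSemidef_iff_real.1 h1).1, h2⟩

/-- The shift to k + 1 matters: the initial guess is only symmetric and stabilizing, and need not
dominate the first iterate. -/
lemma IsNewtonKleinman.posSemidef {S : ℕ → Mat d} (hQ : Q.PosSemidef) (hR : R.PosDef)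
    (hP : Pᵀ = P) (hs : IsStable (A - fMat B R * P))
    (hS : IsNewtonKleinman A (fMat B R) Q P S) (k : ℕ) :
    (S (k + 1)).PosSemidef ∧ (S (k + 1) - S (k + 2)).PosSemidef := by
  obtain ⟨h1, h2⟩ := hS.isStable hQ hR hP hs k
  have h := hS.2 k
  rw [mul_fMat_mul hR h1, fMat_mul] at h
  rw [fMat_mul] at h2
  exact ⟨(kleinman_step hQ hR h2 h).1, kleinman_step_antitone hQ hR h2 h (hS.2 (k + 1))⟩

lemma isClosed_posSemidef : IsClosed {M : Mat d | M.PosSemidef} := by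
  have : {M : Mat d | M.PosSemidef} = {M | Mᵀ = M} ∩ ⋂ x, {M | 0 ≤ x ⬝ᵥ M *ᵥ x} := by
    ext M; simp [posSemidef_iff_real]
  rw [this]
  refine (isClosed_eq (by fun_prop) (by fun_prop)).inter (isClosed_iInter fun x => ?_)
  exact isClosed_le (by fun_prop) (by fun_prop)

/-- The quadratic forms decrease and are bounded below; polarization recovers the entries. -/
lemma exists_tendsto_of_posSemidef_antitone {S : ℕ → Mat d} (h0 : ∀ k, (S k).PosSemidef)
    (h1 : ∀ k, (S k - S (k + 1)).PosSemidef) : ∃ P, Tendsto S atTop (𝓝 P) := by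
  have hq : ∀ x : Fin d → ℝ, ∃ l, Tendsto (fun k => x ⬝ᵥ S k *ᵥ x) atTop (𝓝 l) := by
    intro x
    refine ⟨_, tendsto_atTop_ciInf (antitone_nat_of_succ_le fun k => ?_)
      ⟨0, fun _ ⟨k, hk⟩ => hk ▸ (posSemidef_iff_real.1 (h0 k)).2 x⟩⟩
    have := (posSemidef_iff_real.1 (h1 k)).2 x
    rw [Matrix.sub_mulVec, dotProduct_sub] at this
    linarith
  have he : ∀ i j, ∃ l, Tendsto (fun k => S k i j) atTop (𝓝 l) := by
    intro i j
    obtain ⟨l₁, hl₁⟩ := hq (Pi.single i 1 + Pi.single j 1)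
    obtain ⟨l₂, hl₂⟩ := hq (Pi.single i 1)
    obtain ⟨l₃, hl₃⟩ := hq (Pi.single j 1)
    refine ⟨(l₁ - l₂ - l₃) / 2, (((hl₁.sub hl₂).sub hl₃).div_const 2).congr fun k => ?_⟩
    have hsym : S k j i = S k i j := congrFun (congrFun (posSemidef_iff_real.1 (h0 k)).1 i) j
    simp only [Matrix.mulVec_add, add_dotProduct, dotProduct_add, Matrix.mulVec_single_one,
      single_dotProduct, one_mul, Matrix.col_apply, hsym]
    ring
  choose P hP using he
  exact ⟨P, tendsto_pi_nhds.2 fun i => tendsto_pi_nhds.2 fun j => hP i j⟩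

lemma IsNewtonKleinman.exists_tendsto {S : ℕ → Mat d} (hQ : Q.PosSemidef) (hR : R.PosDef)
    (hP : Pᵀ = P) (hs : IsStable (A - fMat B R * P))
    (hS : IsNewtonKleinman A (fMat B R) Q P S) :
    ∃ P', Tendsto S atTop (𝓝 P') ∧ IsRiccatiSolution A (fMat B R) Q P' := by
  have hpos := hS.posSemidef hQ hR hP hs
  obtain ⟨P', hP'⟩ := exists_tendsto_of_posSemidef_antitone (S := fun k => S (k + 1))
    (fun k => (hpos k).1) (fun k => (hpos k).2)
  have hlim : Tendsto S atTop (𝓝 P') := (tendsto_add_atTop_iff_nat 1).1 hP'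
  refine ⟨P', hlim, isClosed_posSemidef.mem_of_tendsto hP' (Eventually.of_forall fun k =>
    (hpos k).1), ?_⟩
  set F := fMat B R
  have hc : Continuous fun X : Mat d × Mat d =>
      (A - F * X.1)ᵀ * X.2 + X.2 * (A - F * X.1) + (X.1 * F * X.1) + Q := by fun_prop
  have h1 := (hc.tendsto (P', P')).comp (hlim.prodMk_nhds hP')
  have h2 : ∀ k, (A - F * S k)ᵀ * S (k + 1) + S (k + 1) * (A - F * S k) + (S k * F * S k) + Q
      = 0 := by
    intro k; rw [hS.2 k]; abel
  have h3 := tendsto_nhds_unique (h1.congr h2) tendsto_const_nhds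
  have hPt : P'ᵀ = P' := (posSemidef_iff_real.1 (isClosed_posSemidef.mem_of_tendsto hP'
    (Eventually.of_forall fun k => (hpos k).1))).1
  have hFt : (F * P')ᵀ * P' = P' * F * P' := by
    rw [Matrix.transpose_mul, hPt, transpose_fMat hR]
  simp only [Matrix.transpose_sub, Matrix.sub_mul, Matrix.mul_sub, hFt] at h3
  rw [← h3, Matrix.mul_assoc]
  abel

lemma existsUnique_isNewtonKleinman (hQ : Q.PosSemidef) (hR : R.PosDef)
    (hP : Pᵀ = P) (hs : IsStable (A - fMat B R * P)) :
    ∃ S, IsNewtonKleinman A (fMat B R) Q P S ∧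
      ∀ S', IsNewtonKleinman A (fMat B R) Q P S' → S' = S := by
  -- The step map is made total by the value 0 off stabilizing matrices; no iterate meets this
  -- default.
  have hex : ∀ X, ∃ Y, IsStable (A - fMat B R * X) →
      (A - fMat B R * X)ᵀ * Y + Y * (A - fMat B R * X) = -(X * fMat B R * X) - Q := by
    intro X
    by_cases h : IsStable (A - fMat B R * X)
    · obtain ⟨Y, hY, -⟩ := existsUnique_lyapunov h (-(X * fMat B R * X) - Q)
      exact ⟨Y, fun _ => hY⟩
    · exact ⟨0, fun h' => absurd h' h⟩
  choose g hg using hex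
  let S : ℕ → Mat d := fun k => g^[k] P
  have hsucc : ∀ k, S (k + 1) = g (S k) := fun k => Function.iterate_succ_apply' g k P
  have hst : ∀ k, (S k)ᵀ = S k ∧ IsStable (A - fMat B R * S k) := by
    intro k
    induction k with
    | zero => exact ⟨hP, hs⟩
    | succ k ih =>
      have h := hg _ ih.2
      rw [← hsucc, mul_fMat_mul hR ih.1, fMat_mul] at h
      rw [fMat_mul] at ih
      obtain ⟨h1, h2⟩ := kleinman_step hQ hR ih.2 h
      exact ⟨(posSemidef_iff_real.1 h1).1, h2⟩
  have hNK : IsNewtonKleinman A (fMat B R) Q P S :=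
    ⟨rfl, fun k => by rw [hsucc]; exact hg _ (hst k).2⟩
  refine ⟨S, hNK, fun S' hS' => funext fun k => ?_⟩
  induction k with
  | zero => rw [hS'.1, hNK.1]
  | succ k ih =>
    have h := hS'.2 k
    rw [ih] at h
    exact (existsUnique_lyapunov (hst k).2 _).unique h (hNK.2 k)

/-! ### Existence, stabilization and uniqueness for the Riccati equation -/

lemma exists_isRiccatiSolution (hQ : Q.PosSemidef) (hR : R.PosDef) (h : IsStabilizable A B) :
    ∃ P, IsRiccatiSolution A (fMat B R) Q P := by
  obtain ⟨K, hK⟩ := h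
  obtain ⟨P, hP, -⟩ := existsUnique_lyapunov hK (-(Kᵀ * R * K) - Q)
  obtain ⟨h1, h2⟩ := kleinman_step hQ hR hK hP
  have hPt := (posSemidef_iff_real.1 h1).1
  obtain ⟨S, hS, -⟩ := existsUnique_isNewtonKleinman hQ hR hPt h2
  obtain ⟨P', -, h'⟩ := hS.exists_tendsto hQ hR hPt h2
  exact ⟨P', h'⟩

open scoped MatrixOrder in
lemma sqrtMat_spec (hQ : Q.PosSemidef) : (sqrtMat Q)ᵀ = sqrtMat Q ∧ sqrtMat Q * sqrtMat Q = Q := by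
  refine ⟨(posSemidef_iff_real.1 ?_).1, CFC.sqrt_mul_sqrt_self Q hQ.nonneg⟩
  exact Matrix.nonneg_iff_posSemidef.1 (CFC.sqrt_nonneg Q)

/-- An unstable mode would be killed by both the gain of P and Q^{1/2}, hence would survive in the
stable matrix A - LᵀQ^{1/2}. -/
lemma IsRiccatiSolution.isStable (hQ : Q.PosSemidef) (hR : R.PosDef)
    (hdet : IsDetectable A (sqrtMat Q)) (h : IsRiccatiSolution A (fMat B R) Q P) :
    IsStable (A - fMat B R * P) := by
  obtain ⟨hP, heq⟩ := h
  have hPt := (posSemidef_iff_real.1 hP).1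
  obtain ⟨L, hL⟩ := hdet
  have hL' : IsStable (A - Lᵀ * sqrtMat Q) := by
    have := hL.transpose
    rwa [Matrix.transpose_sub, Matrix.transpose_transpose, Matrix.transpose_mul,
      Matrix.transpose_transpose] at this
  have p2 : (P * fMat B R * P).PosSemidef := by
    rw [mul_fMat_mul hR hPt]; exact posSemidef_conj hR.posSemidef _
  have hFt : (fMat B R * P)ᵀ * P = P * fMat B R * P := by
    rw [Matrix.transpose_mul, hPt, transpose_fMat hR]
  have hly : (A - fMat B R * P)ᵀ * P + P * (A - fMat B R * P) = -(P * fMat B R * P + Q) := by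
    rw [Matrix.transpose_sub, Matrix.sub_mul, hFt, Matrix.mul_sub, ← Matrix.mul_assoc,
      ← sub_eq_zero, ← heq]
    abel
  refine isStable_of_lyapunov hP (posSemidef_iff_real.1 (p2.add hQ)).2 hly ?_
  intro σ ω a b hσ hab ha hb
  obtain ⟨hs1, hs2⟩ := sqrtMat_spec hQ
  have key : ∀ x, x ⬝ᵥ (P * fMat B R * P + Q) *ᵥ x = 0 →
      (A - Lᵀ * sqrtMat Q) *ᵥ x = (A - fMat B R * P) *ᵥ x := by
    intro x hx
    rw [Matrix.add_mulVec, dotProduct_add] at hx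
    have q1 := (posSemidef_iff_real.1 p2).2 x
    have q2 := (posSemidef_iff_real.1 hQ).2 x
    have z1 : x ⬝ᵥ (P * fMat B R * P) *ᵥ x = 0 := by linarith
    have z2 : x ⬝ᵥ ((sqrtMat Q)ᵀ * 1 * sqrtMat Q) *ᵥ x = 0 := by
      rw [hs1, mul_one, hs2]; linarith
    rw [mul_fMat_mul hR hPt] at z1
    have w1 := mulVec_eq_zero_of_dotProduct_eq_zero hR z1
    have w2 := mulVec_eq_zero_of_dotProduct_eq_zero Matrix.PosDef.one z2
    rw [fMat_mul, Matrix.sub_mulVec, Matrix.sub_mulVec, ← Matrix.mulVec_mulVec,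
      ← Matrix.mulVec_mulVec, w1, w2, Matrix.mulVec_zero, Matrix.mulVec_zero]
  have := isStable_iff.1 hL' σ ω a b
    ⟨hab.ne_zero, (key a ha).trans hab.left, (key b hb).trans hab.right⟩
  linarith

lemma IsRiccatiSolution.unique {P' : Mat d} (hQ : Q.PosSemidef) (hR : R.PosDef)
    (hdet : IsDetectable A (sqrtMat Q)) (h : IsRiccatiSolution A (fMat B R) Q P)
    (h' : IsRiccatiSolution A (fMat B R) Q P') : P = P' := by
  have hPt := (posSemidef_iff_real.1 h.1).1
  rw [← sub_eq_zero]
  refine sylvester_eq_zero (h.isStable hQ hR hdet) (h'.isStable hQ hR hdet) ?_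
  rw [Matrix.transpose_sub, Matrix.transpose_mul, hPt, transpose_fMat hR]
  have e : (Aᵀ - P * fMat B R) * (P - P') + (P - P') * (A - fMat B R * P') =
      (Aᵀ * P + P * A - P * fMat B R * P + Q) -
      (Aᵀ * P' + P' * A - P' * fMat B R * P' + Q) := by noncomm_ring
  rw [e, h.2, h'.2, sub_zero]

lemma riccatiSolution_spec (hQ : Q.PosSemidef) (hR : R.PosDef) (h : IsStabilizable A B) :
    IsRiccatiSolution A (fMat B R) Q (riccatiSolution A (fMat B R) Q) := by
  have hex := exists_isRiccatiSolution hQ hR h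
  rw [riccatiSolution, dif_pos hex]
  exact hex.choose_spec

lemma lyapunovSolution_spec {M : Mat d} (h : IsStable M) :
    IsLyapunovSolution M (lyapunovSolution M) := by
  have hex : ∃ H, IsLyapunovSolution M H := (existsUnique_lyapunov h (-1)).exists
  rw [lyapunovSolution, dif_pos hex]
  exact hex.choose_spec

end

/-! ### Norm estimates and perturbation of stable matrices -/

lemma opNorm_nonneg {d : ℕ} (M : Mat d) : 0 ≤ opNorm M := norm_nonneg _

lemma opNorm_add_le {d : ℕ} (M N : Mat d) : opNorm (M + N) ≤ opNorm M + opNorm N := by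
  simpa only [opNorm, map_add] using norm_add_le _ _

lemma opNorm_mul_le {d : ℕ} (M N : Mat d) : opNorm (M * N) ≤ opNorm M * opNorm N := by
  simpa only [opNorm, map_mul] using norm_mul_le _ _

lemma inner_toEuclideanCLM_le {d : ℕ} (M : Mat d) (x y : State d) :
    inner ℝ (toEuclideanCLM (n := Fin d) (𝕜 := ℝ) M x) y ≤ opNorm M * ‖x‖ * ‖y‖ :=
  (real_inner_le_norm _ _).trans
    (mul_le_mul_of_nonneg_right (ContinuousLinearMap.le_opNorm _ _) (norm_nonneg _))

lemma dotProduct_self_nonneg_real {d : ℕ} (x : Fin d → ℝ) : 0 ≤ x ⬝ᵥ x :=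
  Finset.sum_nonneg fun i _ => mul_self_nonneg (x i)

lemma dotProduct_mulVec_le {d : ℕ} (M : Mat d) (x : Fin d → ℝ) :
    x ⬝ᵥ M *ᵥ x ≤ opNorm M * (x ⬝ᵥ x) := by
  have h := inner_toEuclideanCLM_le M (WithLp.toLp 2 x) (WithLp.toLp 2 x)
  rw [real_inner_comm, Matrix.inner_toEuclideanCLM, mul_assoc, ← sq,
    ← real_inner_self_eq_norm_sq, EuclideanSpace.inner_eq_star_dotProduct, star_trivial] at h
  exact h

/-- H remains a Lyapunov function: the right-hand side changes by 2xᵀHEx ≤ 2‖H‖‖E‖|x|², less than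
|x|² for x ≠ 0. -/
lemma IsStable.add_of_opNorm_lt {d : ℕ} {M E H : Mat d} (hM : IsStable M)
    (hH : IsLyapunovSolution M H) (h : 2 * opNorm E * opNorm H < 1) : IsStable (M + E) := by
  have hpos : H.PosSemidef := lyapunov_posSemidef hM Matrix.PosSemidef.one hH
  have hbound : ∀ x : Fin d → ℝ, (1 - 2 * opNorm E * opNorm H) * (x ⬝ᵥ x) ≤
      x ⬝ᵥ (1 - (Eᵀ * H + H * E)) *ᵥ x := by
    intro x
    rw [Matrix.sub_mulVec, Matrix.one_mulVec, dotProduct_sub,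
      dotProduct_lyapunov (posSemidef_iff_real.1 hpos).1, Matrix.mulVec_mulVec]
    have h1 := dotProduct_mulVec_le (H * E) x
    have h2 := mul_le_mul_of_nonneg_right (opNorm_mul_le H E) (dotProduct_self_nonneg_real x)
    linarith
  refine isStable_of_lyapunov hpos (W := 1 - (Eᵀ * H + H * E))
    (fun x => le_trans (mul_nonneg (by linarith) (dotProduct_self_nonneg_real x)) (hbound x)) ?_ ?_
  · have e : (M + E)ᵀ * H + H * (M + E) = (Mᵀ * H + H * M) + (Eᵀ * H + H * E) := by
      rw [Matrix.transpose_add]; noncomm_ring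
    rw [e, show Mᵀ * H + H * M = -1 from hH]; abel
  · intro σ ω a b _ hab ha hb
    have key : ∀ x : Fin d → ℝ, x ⬝ᵥ (1 - (Eᵀ * H + H * E)) *ᵥ x = 0 → x = 0 := by
      intro x hx
      have h1 := hbound x
      rw [hx] at h1
      have h2 : x ⬝ᵥ x ≤ 0 := by
        by_contra! h3
        have := mul_pos (show 0 < 1 - 2 * opNorm E * opNorm H by linarith) h3
        linarith
      exact dotProduct_self_eq_zero.1 (le_antisymm h2 (dotProduct_self_nonneg_real x))
    exact hab.ne_zero.elim (fun h => h (key a ha)) (fun h => h (key b hb))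

/-! ### One-sided Lipschitz constants -/

/-- Gronwall for either sign of L: e^{-2Lt}‖y - z‖² has nonpositive derivative. -/
lemma IsOneSidedLipschitz.norm_sub_le {d : ℕ} {Ω : Set (State d)} {f : State d → State d} {L T : ℝ}
    (hL : IsOneSidedLipschitz Ω f L) {y z : ℝ → State d}
    (hy : ∀ t ∈ Set.Icc 0 T, y t ∈ Ω ∧ HasDerivWithinAt y (f (y t)) (Set.Icc 0 T) t)
    (hz : ∀ t ∈ Set.Icc 0 T, z t ∈ Ω ∧ HasDerivWithinAt z (f (z t)) (Set.Icc 0 T) t)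
    {t : ℝ} (ht : t ∈ Set.Icc 0 T) :
    ‖y t - z t‖ ≤ Real.exp (L * t) * ‖y 0 - z 0‖ := by
  have hder : ∀ s ∈ Set.Icc 0 T,
      HasDerivWithinAt (fun s => Real.exp (-(2 * L) * s) * ‖y s - z s‖ ^ 2)
        (Real.exp (-(2 * L) * s) * (-(2 * L)) * ‖y s - z s‖ ^ 2 +
          Real.exp (-(2 * L) * s) * (2 * inner ℝ (y s - z s) (f (y s) - f (z s))))
        (Set.Icc 0 T) s := by
    intro s hs
    have h1 : HasDerivWithinAt (fun s => Real.exp (-(2 * L) * s))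
        (Real.exp (-(2 * L) * s) * (-(2 * L))) (Set.Icc 0 T) s := by
      simpa using (((hasDerivAt_id s).const_mul (-(2 * L))).exp).hasDerivWithinAt
    exact h1.mul ((hy s hs).2.sub (hz s hs).2).norm_sq
  have hanti : AntitoneOn (fun s => Real.exp (-(2 * L) * s) * ‖y s - z s‖ ^ 2) (Set.Icc 0 T) := by
    refine antitoneOn_of_hasDerivWithinAt_nonpos (convex_Icc 0 T)
      (fun s hs => (hder s hs).continuousWithinAt)
      (fun s hs => (hder s (interior_subset hs)).mono interior_subset) fun s hs => ?_
    have hs' := interior_subset hs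
    have h1 := hL _ (hy s hs').1 _ (hz s hs').1
    rw [real_inner_comm] at h1
    have h2 := mul_le_mul_of_nonneg_left h1 (Real.exp_pos (-(2 * L) * s)).le
    linarith
  have h0 := hanti (Set.left_mem_Icc.2 (ht.1.trans ht.2)) ht ht.1
  simp only [mul_zero, Real.exp_zero, one_mul] at h0
  refine le_of_sq_le_sq ?_ (by positivity)
  have h1 := mul_le_mul_of_nonneg_left h0 (Real.exp_pos (2 * L * t)).le
  rw [← mul_assoc, ← Real.exp_add] at h1
  rw [mul_pow, ← Real.exp_nat_mul]
  have e1 : 2 * L * t + -(2 * L) * t = 0 := by ring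
  have e2 : ((2 : ℕ) : ℝ) * (L * t) = 2 * L * t := by push_cast; ring
  rw [e1, Real.exp_zero, one_mul] at h1
  rw [e2]
  exact h1

/-! ### The logarithmic norm -/

lemma re_inner_map_eq {d : ℕ} (M : Mat d) (v : EuclideanSpace ℂ (Fin d)) :
    (inner ℂ v (toEuclideanCLM (n := Fin d) (𝕜 := ℂ) (M.map (algebraMap ℝ ℂ)) v)).re =
      (fun j => (v j).re) ⬝ᵥ M *ᵥ (fun j => (v j).re) +
      (fun j => (v j).im) ⬝ᵥ M *ᵥ (fun j => (v j).im) := by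
  have h : ∀ i, toEuclideanCLM (n := Fin d) (𝕜 := ℂ) (M.map (algebraMap ℝ ℂ)) v i =
      (M.map (algebraMap ℝ ℂ) *ᵥ v.ofLp) i := fun i => rfl
  rw [PiLp.inner_apply, Complex.re_sum, dotProduct, dotProduct, ← Finset.sum_add_distrib]
  refine Finset.sum_congr rfl fun i _ => ?_
  rw [h, ← re_map_mulVec M v.ofLp i, ← im_map_mulVec M v.ofLp i, RCLike.inner_apply]
  simp [Complex.mul_re]; ring

lemma norm_sq_eq_re_im {d : ℕ} (v : EuclideanSpace ℂ (Fin d)) :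
    ‖v‖ ^ 2 = (fun j => (v j).re) ⬝ᵥ (fun j => (v j).re) +
      (fun j => (v j).im) ⬝ᵥ (fun j => (v j).im) := by
  rw [EuclideanSpace.norm_sq_eq, dotProduct, dotProduct, ← Finset.sum_add_distrib]
  refine Finset.sum_congr rfl fun i _ => ?_
  rw [← Complex.normSq_eq_norm_sq, Complex.normSq_apply]

lemma re_inner_map_div_le {d : ℕ} (M : Mat d) (v : EuclideanSpace ℂ (Fin d)) :
    (inner ℂ v (toEuclideanCLM (n := Fin d) (𝕜 := ℂ) (M.map (algebraMap ℝ ℂ)) v)).re / ‖v‖ ^ 2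
      ≤ opNorm M := by
  refine div_le_of_le_mul₀ (by positivity) (opNorm_nonneg M) ?_
  rw [re_inner_map_eq, norm_sq_eq_re_im, mul_add]
  exact add_le_add (dotProduct_mulVec_le M _) (dotProduct_mulVec_le M _)

lemma logNorm_map_le {d : ℕ} (M : Mat d) : logNorm (M.map (algebraMap ℝ ℂ)) ≤ opNorm M :=
  Real.iSup_le (fun v => re_inner_map_div_le M v.1) (opNorm_nonneg M)

lemma inner_toEuclideanCLM_le_logNorm {d : ℕ} (M : Mat d) (x : State d) :
    inner ℝ (toEuclideanCLM (n := Fin d) (𝕜 := ℝ) M x) x ≤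
      logNorm (M.map (algebraMap ℝ ℂ)) * ‖x‖ ^ 2 := by
  rcases eq_or_ne x 0 with rfl | hx
  · simp
  let v : EuclideanSpace ℂ (Fin d) := WithLp.toLp 2 fun j => (x j : ℂ)
  have hv : v ≠ 0 := fun h0 => hx (by
    ext j
    exact Complex.ofReal_eq_zero.1 (congrFun (congrArg WithLp.ofLp h0) j))
  have hbdd : BddAbove (Set.range fun v : {x : EuclideanSpace ℂ (Fin d) // x ≠ 0} =>
      (inner ℂ v.1 (toEuclideanCLM (n := Fin d) (𝕜 := ℂ) (M.map (algebraMap ℝ ℂ)) v.1)).re /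
        ‖v.1‖ ^ 2) := ⟨opNorm M, fun _ ⟨v, hv⟩ => hv ▸ re_inner_map_div_le M v.1⟩
  have h := le_ciSup hbdd ⟨v, hv⟩
  have hn : ‖v‖ ^ 2 = ‖x‖ ^ 2 := by
    rw [EuclideanSpace.norm_sq_eq, EuclideanSpace.norm_sq_eq]
    simp [v]
  have hi : (inner ℂ v (toEuclideanCLM (n := Fin d) (𝕜 := ℂ) (M.map (algebraMap ℝ ℂ)) v)).re =
      inner ℝ (toEuclideanCLM (n := Fin d) (𝕜 := ℝ) M x) x := by
    rw [re_inner_map_eq, real_inner_comm, Matrix.inner_toEuclideanCLM]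
    have h1 : (fun j => (v j).re) = x.ofLp := funext fun j => Complex.ofReal_re _
    have h2 : (fun j => (v j).im) = 0 := funext fun j => Complex.ofReal_im _
    rw [h1, h2, zero_dotProduct, add_zero]
  simp only [hn, hi] at h
  rwa [div_le_iff₀ (by positivity)] at h

lemma isOneSidedLipschitz_of_bounded {d : ℕ} {Ω : Set (State d)} {M : State d → Mat d} {K : ℝ}
    (hΩ : Bornology.IsBounded Ω) (hK : 0 ≤ K)
    (hM : ∀ x ∈ Ω, ∀ y ∈ Ω, opNorm (M x - M y) ≤ K * ‖x - y‖) :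
    IsOneSidedLipschitz Ω (fun x => toEuclideanCLM (n := Fin d) (𝕜 := ℝ) (M x) x)
      ((⨆ x : Ω, logNorm ((M x.1).map (algebraMap ℝ ℂ))) + K * ⨆ y : Ω, ‖y.1‖) := by
  intro x hx y hy
  obtain ⟨C, hC⟩ := hΩ.exists_norm_le
  have hbdd₁ : BddAbove (Set.range fun z : Ω => ‖z.1‖) := ⟨C, fun _ ⟨z, hz⟩ => hz ▸ hC z.1 z.2⟩
  have hbdd₂ : BddAbove (Set.range fun z : Ω => logNorm ((M z.1).map (algebraMap ℝ ℂ))) := by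
    -- Comparison with the fixed matrix M x; without boundedness the real supremum would default to
    -- 0.
    refine ⟨K * (C + C) + opNorm (M x), ?_⟩
    rintro _ ⟨z, rfl⟩
    have h1 := opNorm_add_le (M z.1 - M x) (M x)
    rw [sub_add_cancel] at h1
    have h2 := mul_le_mul_of_nonneg_left
      ((norm_sub_le z.1 x).trans (add_le_add (hC z.1 z.2) (hC x hx))) hK
    linarith [logNorm_map_le (M z.1), hM z.1 z.2 x hx]
  have h1 := le_ciSup hbdd₂ ⟨x, hx⟩
  have h2 := le_ciSup hbdd₁ ⟨y, hy⟩
  simp only at h1 h2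
  -- The first summand is controlled by the logarithmic norm, the second by the Lipschitz bound and
  -- the size of y.
  have e : toEuclideanCLM (n := Fin d) (𝕜 := ℝ) (M x) x -
      toEuclideanCLM (n := Fin d) (𝕜 := ℝ) (M y) y =
      toEuclideanCLM (n := Fin d) (𝕜 := ℝ) (M x) (x - y) +
      toEuclideanCLM (n := Fin d) (𝕜 := ℝ) (M x - M y) y := by
    rw [map_sub, map_sub, _root_.sub_apply]; abel
  simp only [e, inner_add_left]
  have h3 := inner_toEuclideanCLM_le_logNorm (M x) (x - y)
  have h4 := inner_toEuclideanCLM_le (M x - M y) y (x - y)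
  have h5 : opNorm (M x - M y) * ‖y‖ * ‖x - y‖ ≤
      K * ‖x - y‖ * (⨆ y : Ω, ‖y.1‖) * ‖x - y‖ := by
    gcongr
    exact hM x hx y hy
  have h6 := mul_le_mul_of_nonneg_right h1 (sq_nonneg ‖x - y‖)
  linarith

end SDRE

/-! ### Assembly of the proposition -/

theorem proposition3p1 {d m : ℕ}
    (A : SDRE.State d → SDRE.Mat d) (B : Matrix (Fin d) (Fin m) ℝ)
    (Q : SDRE.Mat d) (R : Matrix (Fin m) (Fin m) ℝ)
    (hQ : Q.PosSemidef) (hR : R.PosDef)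
    (F : SDRE.Mat d) (hF : F = SDRE.fMat B R)
    (Ω : Set (SDRE.State d)) (Par : Set ℝ) (y₀ : ℝ → SDRE.State d)
    (hy₀Ω : ∀ μ ∈ Par, y₀ μ ∈ Ω)
    (Lcl LA Ly₀ : ℝ) (hLcl : 0 < Lcl) (hLA : 0 < LA) (hLy₀ : 0 < Ly₀)
    (hAcl : ∀ x ∈ Ω, ∀ y ∈ Ω,
      SDRE.opNorm (SDRE.closedLoop A F Q x - SDRE.closedLoop A F Q y) ≤ Lcl * ‖x - y‖)
    (hstab : ∀ x ∈ Ω, SDRE.IsStabilizable (A x) B)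
    (hdet : ∀ x ∈ Ω, SDRE.IsDetectable (A x) (SDRE.sqrtMat Q))
    (hy₀ : ∀ μ ∈ Par, ∀ ν ∈ Par, ‖y₀ μ - y₀ ν‖ ≤ Ly₀ * |μ - ν|)
    (hA : ∀ x ∈ Ω, ∀ y ∈ Ω, SDRE.opNorm (A x - A y) ≤ LA * ‖x - y‖) :
    -- the Riccati solution `P(x)` and the Lyapunov solution `H(x)` are well defined on `Ω`
    (∀ x ∈ Ω, (∃! P, SDRE.IsRiccatiSolution (A x) F Q P) ∧
      ∃! H, SDRE.IsLyapunovSolution (SDRE.closedLoop A F Q x) H) ∧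
    -- an explicit one-sided Lipschitz constant when `Ω` is bounded
    (Bornology.IsBounded Ω →
      SDRE.IsOneSidedLipschitz Ω (SDRE.closedLoopField A F Q)
        (SDRE.closedLoopConstant A F Q Ω Lcl)) ∧
    ∀ μ ∈ Par, ∀ Δμ : ℝ, 0 < Δμ → μ + Δμ ∈ Par →
      Δμ < 1 / (2 * LA * Ly₀ *
        SDRE.opNorm (SDRE.lyapunovSolution (SDRE.closedLoop A F Q (y₀ μ)))) →
      -- stability at the initial time
      SDRE.IsStable (A (y₀ (μ + Δμ)) - F * SDRE.riccatiSolution (A (y₀ μ)) F Q) ∧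
      -- stability and Newton-Kleinman convergence on `[0, T]`
      ∀ (T : ℝ), 0 < T → ∀ y : ℝ → ℝ → SDRE.State d,
        (∀ ν ∈ ({μ, μ + Δμ} : Set ℝ), SDRE.IsTrajectory A F Q Ω T (y₀ ν) (y ν)) →
        ∀ L : ℝ, SDRE.IsOneSidedLipschitz Ω (SDRE.closedLoopField A F Q) L →
        (∀ t ∈ Set.Ioc 0 T, L < -(1 / t) * Real.log (2 * LA * Ly₀ * Δμ *
          SDRE.opNorm (SDRE.lyapunovSolution (SDRE.closedLoop A F Q (y μ t))))) →
        ∀ t ∈ Set.Icc 0 T,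
          SDRE.IsStable (A (y (μ + Δμ) t) - F * SDRE.riccatiSolution (A (y μ t)) F Q) ∧
          ∃ S : ℕ → SDRE.Mat d,
            SDRE.IsNewtonKleinman (A (y (μ + Δμ) t)) F Q
              (SDRE.riccatiSolution (A (y μ t)) F Q) S ∧
            (∀ S' : ℕ → SDRE.Mat d,
              SDRE.IsNewtonKleinman (A (y (μ + Δμ) t)) F Q
                (SDRE.riccatiSolution (A (y μ t)) F Q) S' → S' = S) ∧
            Tendsto S atTop (𝓝 (SDRE.riccatiSolution (A (y (μ + Δμ) t)) F Q)) := by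
  subst hF
  have hP : ∀ x ∈ Ω, SDRE.IsRiccatiSolution (A x) (SDRE.fMat B R) Q
      (SDRE.riccatiSolution (A x) (SDRE.fMat B R) Q) :=
    fun x hx => SDRE.riccatiSolution_spec hQ hR (hstab x hx)
  have hPt : ∀ x ∈ Ω, (SDRE.riccatiSolution (A x) (SDRE.fMat B R) Q)ᵀ =
      SDRE.riccatiSolution (A x) (SDRE.fMat B R) Q :=
    fun x hx => (SDRE.posSemidef_iff_real.1 (hP x hx).1).1
  have hs : ∀ x ∈ Ω, SDRE.IsStable (SDRE.closedLoop A (SDRE.fMat B R) Q x) :=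
    fun x hx => (hP x hx).isStable hQ hR (hdet x hx)
  have hpert : ∀ x ∈ Ω, ∀ x' ∈ Ω, 2 * (LA * ‖x' - x‖) *
      SDRE.opNorm (SDRE.lyapunovSolution (SDRE.closedLoop A (SDRE.fMat B R) Q x)) < 1 →
      SDRE.IsStable (A x' - SDRE.fMat B R * SDRE.riccatiSolution (A x) (SDRE.fMat B R) Q) := by
    intro x hx x' hx' h
    have h1 := (hs x hx).add_of_opNorm_lt (E := A x' - A x) (SDRE.lyapunovSolution_spec (hs x hx))
      (lt_of_le_of_lt (mul_le_mul_of_nonneg_right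
        (mul_le_mul_of_nonneg_left (hA x' hx' x hx) zero_le_two) (SDRE.opNorm_nonneg _)) h)
    rwa [SDRE.closedLoop, sub_add_eq_add_sub, add_sub_cancel] at h1
  refine ⟨fun x hx => ⟨⟨_, hP x hx, fun P' hP' => hP'.unique hQ hR (hdet x hx) (hP x hx)⟩,
    SDRE.existsUnique_lyapunov (hs x hx) (-1)⟩,
    fun hΩ => SDRE.isOneSidedLipschitz_of_bounded hΩ hLcl.le hAcl, ?_⟩
  intro μ hμ Δμ hΔ hμΔ hsmall
  have hy₀Δ : ‖y₀ (μ + Δμ) - y₀ μ‖ ≤ Ly₀ * Δμ := by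
    simpa [abs_of_pos hΔ] using hy₀ _ hμΔ _ hμ
  have hinit : SDRE.IsStable (A (y₀ (μ + Δμ)) -
      SDRE.fMat B R * SDRE.riccatiSolution (A (y₀ μ)) (SDRE.fMat B R) Q) := by
    refine hpert _ (hy₀Ω μ hμ) _ (hy₀Ω _ hμΔ) ?_
    set h := SDRE.opNorm (SDRE.lyapunovSolution (SDRE.closedLoop A (SDRE.fMat B R) Q (y₀ μ)))
    have hh : 0 ≤ h := SDRE.opNorm_nonneg _
    -- As 1/0 = 0, the bound (1) with Δμ > 0 already excludes h = 0.
    have hpos : 0 < 2 * LA * Ly₀ * h := one_div_pos.1 (hΔ.trans hsmall)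
    rw [lt_div_iff₀ hpos] at hsmall
    calc 2 * (LA * ‖y₀ (μ + Δμ) - y₀ μ‖) * h ≤ 2 * (LA * (Ly₀ * Δμ)) * h := by gcongr
      _ = Δμ * (2 * LA * Ly₀ * h) := by ring
      _ < 1 := hsmall
  refine ⟨hinit, fun T hT y hy L hL hLt t ht => ?_⟩
  have hyμ := hy μ (by simp)
  have hyν := hy (μ + Δμ) (by simp)
  have hst : SDRE.IsStable (A (y (μ + Δμ) t) -
      SDRE.fMat B R * SDRE.riccatiSolution (A (y μ t)) (SDRE.fMat B R) Q) := by
    -- Condition (2) says nothing at t = 0, where (1) takes over.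
    rcases ht.1.eq_or_lt with rfl | ht0
    · rw [hyμ.1, hyν.1]; exact hinit
    refine hpert _ (hyμ.2 t ht).1 _ (hyν.2 t ht).1 ?_
    have hlt := hLt t ⟨ht0, ht.2⟩
    have hgr := hL.norm_sub_le hyν.2 hyμ.2 ht
    rw [hyμ.1, hyν.1] at hgr
    set h := SDRE.opNorm (SDRE.lyapunovSolution (SDRE.closedLoop A (SDRE.fMat B R) Q (y μ t)))
    have hh : 0 ≤ h := SDRE.opNorm_nonneg _
    have hc : 2 * LA * Ly₀ * Δμ * h < Real.exp (-(L * t)) := by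
      -- If h = 0 the logarithm is a default value, but the bound is trivial.
      rcases hh.eq_or_lt with h0 | h0
      · rw [← h0, mul_zero]; exact Real.exp_pos _
      · rw [← Real.log_lt_iff_lt_exp (by positivity)]
        have := mul_lt_mul_of_pos_right hlt ht0
        have e : ∀ c : ℝ, -(1 / t) * c * t = -c := fun c => by field_simp
        rw [e] at this
        linarith
    calc 2 * (LA * ‖y (μ + Δμ) t - y μ t‖) * h
        ≤ 2 * (LA * (Real.exp (L * t) * (Ly₀ * Δμ))) * h := by
          gcongr
          exact hgr.trans (by gcongr)
      _ = Real.exp (L * t) * (2 * LA * Ly₀ * Δμ * h) := by ring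
      _ < Real.exp (L * t) * Real.exp (-(L * t)) := by gcongr
      _ = 1 := by rw [← Real.exp_add, add_neg_cancel, Real.exp_zero]
  refine ⟨hst, ?_⟩
  have hPμ := hPt _ (hyμ.2 t ht).1
  obtain ⟨S, hS, huniq⟩ := SDRE.existsUnique_isNewtonKleinman hQ hR hPμ hst
  refine ⟨S, hS, huniq, ?_⟩
  obtain ⟨P', hlim, hP'⟩ := hS.exists_tendsto hQ hR hPμ hst
  have hν := (hyν.2 t ht).1
  rwa [hP'.unique hQ hR (hdet _ hν) (hP _ hν)] at hlim
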